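/- **Definitions.** All graphs are finite and simple. For a graph $K$ and a graph $\Gamma$, a $(K,\Gamma)$-design is a set $\mathcal B$ of subgraphs of $K$ (called blocks), each isomorphic to $\Gamma$, whose edge sets partition the edge set of $K$. A $\Gamma$-design of order $v$ is a $(K_V,\Gamma)$-design, where $K_V$ is the complete graph on a vertex set $V$ with $|V|=v$. Given a $(K,\Gamma)$-design $\mathcal B$ and a $(K',\Gamma')$-design $\mathcal B'$ (the vertex sets of $K$ and $K'$ may overlap), a down-link from $\mathcal B$ to $\mathcal B'$ is a map $f:\mathcal B\to\mathcal B'$ such that $f(B)$ is a subgraph of $B$ for every $B\in\mathcal B$. Let $S_k=K_{1,k}$ be the star with $k$ edges and let $P_3$ be the path on three vertices. Let $\mathcal L_1S_k(v)$ be the set of all integers $n\ge 0$ such that there exists some $S_k$-design of order $v$ which admits a down-link to some $P_3$-design of order $n$. **Theorem.** Let $k>3$ be a prime power and let $v$ be an integer with $2k\le v<4k$ and $v(v-1)\equiv 0\pmod{2k}$. Then $v\in\{2k,\,2k+1,\,3k,\,3k+1\}$ and $$\mathcal L_1S_k(v)=\{\,n\ge v-1 : n\equiv 0 \text{ or } 1\pmod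 4\,\}.$$ -/

import Mathlib

namespace DownLink

/-- A graph with a designated vertex set, whose vertices are labelled by elements of `α`:
a subgraph of the complete graph on `α`.  The relation `≤` on these is the subgraph relation
(inclusion of vertex sets and of edge sets). -/
abbrev LGraph (α : Type*) : Type _ := (⊤ : SimpleGraph α).Subgraph

/-- `complete V` is the complete graph `K_V` with vertex set `V`. -/
def complete {α : Type*} (V : Set α) : LGraph α :=
  (⊤ : LGraph α).induce V

/-- `𝓑` is a `(K, Γ)`-design: a set of subgraphs of `K` (the blocks), all isomorphic to `Γ`,
whose edge sets partition the edge set of `K`. -/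
structure IsDesign {α β : Type*} (𝓑 : Set (LGraph α)) (K : LGraph α)
    (Γ : SimpleGraph β) : Prop where
  le : ∀ B ∈ 𝓑, B ≤ K
  iso : ∀ B ∈ 𝓑, Nonempty (B.coe ≃g Γ)
  existsUnique : ∀ e ∈ K.edgeSet, ∃! B, B ∈ 𝓑 ∧ e ∈ B.edgeSet

/-- `f` is a down-link from `𝓑` to `𝓑'`: it maps every block of `𝓑` to a block of `𝓑'` that is
a subgraph of it. -/
def IsDownLink {α : Type*} {𝓑 𝓑' : Set (LGraph α)} (f : 𝓑 → 𝓑') : Prop :=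
  ∀ B : 𝓑, (f B : LGraph α) ≤ (B : LGraph α)

/-- The set `𝓛₁Γ(v)` relative to `Γ'`: all orders `n` such that some `Γ`-design of order `v` is
down-linked to a `Γ'`-design of order `n`.  The two vertex sets are arbitrary finite sets taken
in one common infinite set of labels, and may overlap in any way. -/
def L₁ {β γ : Type*} (Γ : SimpleGraph β) (Γ' : SimpleGraph γ) (v : ℕ) : Set ℕ :=
  {n | ∃ V W : Finset ℕ, V.card = v ∧ W.card = n ∧
    ∃ 𝓑 𝓑' : Set (LGraph ℕ),
      IsDesign 𝓑 (complete (V : Set ℕ)) Γ ∧ IsDesign 𝓑' (complete (W : Set ℕ)) Γ' ∧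
      ∃ f : 𝓑 → 𝓑', IsDownLink f}

/-- The star `S_k` on `k + 1` vertices: the complete bipartite graph `K_{1,k}`. -/
abbrev star (k : ℕ) : SimpleGraph (Fin 1 ⊕ Fin k) := completeBipartiteGraph (Fin 1) (Fin k)

/-- The path `P₃` on three vertices. -/
abbrev P₃ : SimpleGraph (Fin 3) := SimpleGraph.pathGraph 3

end DownLink

namespace DownLink

open Finset

/-- `out` lists the out-neighbours in an orientation of the complete graph on `V`. -/
structure IsTournament (V : Finset ℕ) (out : ℕ → Finset ℕ) : Prop where
  mem : ∀ a b, b ∈ out a → a ∈ V ∧ b ∈ V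
  irrefl : ∀ a, a ∉ out a
  total : ∀ a ∈ V, ∀ b ∈ V, a ≠ b → b ∈ out a ∨ a ∈ out b
  asymm : ∀ a b, b ∈ out a → a ∉ out b

theorem IsTournament.sum_card {V : Finset ℕ} {out : ℕ → Finset ℕ} (h : IsTournament V out) :
    2 * ∑ a ∈ V, (out a).card = V.card * (V.card - 1) := by
  have h1 : ∀ a ∈ V, (out a).card = ∑ b ∈ V, if b ∈ out a then 1 else 0 := by
    intro a _
    rw [← Finset.card_filter]
    congr 1
    ext b
    simp only [Finset.mem_filter]
    exact ⟨fun hb => ⟨(h.mem a b hb).2, hb⟩, fun hb => hb.2⟩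
  rw [Finset.sum_congr rfl h1, two_mul]
  nth_rewrite 2 [Finset.sum_comm]
  rw [← Finset.sum_add_distrib]
  have h2 : ∀ a ∈ V, ((∑ b ∈ V, if b ∈ out a then 1 else 0) +
      ∑ b ∈ V, if a ∈ out b then 1 else 0) = V.card - 1 := by
    intro a ha
    rw [← Finset.sum_add_distrib, ← Finset.card_erase_of_mem ha, Finset.card_eq_sum_ones,
      ← Finset.add_sum_erase V _ ha]
    simp only [h.irrefl a, if_false, add_zero, zero_add]
    refine Finset.sum_congr rfl fun b hb => ?_
    obtain ⟨hne, hb⟩ := Finset.mem_erase.1 hb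
    rcases h.total a ha b hb hne.symm with h' | h'
    · simp [h', h.asymm _ _ h']
    · simp [h', h.asymm _ _ h']
  rw [Finset.sum_congr rfl h2, Finset.sum_const, smul_eq_mul]

/-- Landau's theorem: a tournament with prescribed scores exists when every set of vertices has
large enough total score. -/
theorem exists_isTournament_card_eq (V : Finset ℕ) (t : ℕ → ℕ)
    (h : ∀ X ⊆ V, X.card * (X.card - 1) ≤ 2 * ∑ c ∈ X, t c)
    (hV : V.card * (V.card - 1) = 2 * ∑ c ∈ V, t c) :
    ∃ out, IsTournament V out ∧ ∀ c ∈ V, (out c).card = t c := by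
  classical
  let τ : ↥(V.powersetCard 2) → Finset (Σ _ : ℕ, ℕ) := fun e => e.1.sigma fun c => range (t c)
  have hall : ∀ F : Finset ↥(V.powersetCard 2), F.card ≤ (F.biUnion τ).card := by
    intro F
    let X := F.biUnion fun e => e.1
    have hX : F.biUnion τ = X.sigma fun c => range (t c) := by
      ext ⟨c, i⟩
      simp only [τ, X, mem_biUnion, mem_sigma]
      tauto
    have hXV : X ⊆ V := by
      intro c hc
      obtain ⟨e, _, hce⟩ := mem_biUnion.1 hc
      exact (mem_powersetCard.1 e.2).1 hce
    have h1 : F.card ≤ (X.powersetCard 2).card := by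
      rw [← Finset.card_map (Function.Embedding.subtype _) (s := F)]
      refine Finset.card_le_card fun e he => ?_
      obtain ⟨e, heF, rfl⟩ := mem_map.1 he
      exact mem_powersetCard.2 ⟨fun c hc => mem_biUnion.2 ⟨e, heF, hc⟩, (mem_powersetCard.1 e.2).2⟩
    rw [hX, card_sigma]
    simp only [card_range]
    rw [card_powersetCard, Nat.choose_two_right] at h1
    have := h X hXV
    omega
  obtain ⟨g, hg, hgτ⟩ := (Finset.all_card_le_biUnion_card_iff_exists_injective τ).1 hall
  have hpair : ∀ a b, a ∈ V → b ∈ V → a ≠ b → ({a, b} : Finset ℕ) ∈ V.powersetCard 2 := by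
    intro a b ha hb hab
    refine mem_powersetCard.2 ⟨?_, card_pair hab⟩
    intro x hx
    rcases mem_insert.1 hx with rfl | hx
    · exact ha
    · rwa [mem_singleton.1 hx]
  let γ : ℕ → ℕ → Σ _ : ℕ, ℕ := fun a b =>
    if hab : ({a, b} : Finset ℕ) ∈ V.powersetCard 2 then g ⟨{a, b}, hab⟩ else ⟨0, 0⟩
  have hsymm : ∀ a b, γ a b = γ b a := by
    intro a b
    simp only [γ, Finset.pair_comm a b]
  have hγ : ∀ a b, a ∈ V → b ∈ V → a ≠ b →
      ((γ a b).1 = a ∨ (γ a b).1 = b) ∧ (γ a b).2 < t (γ a b).1 := by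
    intro a b ha hb hab
    have h1 := hgτ ⟨{a, b}, hpair a b ha hb hab⟩
    simp only [τ, mem_sigma, mem_insert, mem_singleton, mem_range] at h1
    simpa only [γ, dif_pos (hpair a b ha hb hab)] using h1
  have hT : IsTournament V fun a => V.filter fun b => a ∈ V ∧ a ≠ b ∧ (γ a b).1 = a := by
    refine ⟨?_, ?_, ?_, ?_⟩
    · intro a b hb
      simp only [mem_filter] at hb
      tauto
    · intro a ha
      simp at ha
    · intro a ha b hb hab
      simp only [mem_filter]
      rcases (hγ a b ha hb hab).1 with h' | h'
      · tauto
      · right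
        refine ⟨ha, hb, hab.symm, ?_⟩
        rw [hsymm, h']
    · intro a b hb ha
      simp only [mem_filter] at hb ha
      rw [hsymm] at ha
      exact hb.2.2.1 (hb.2.2.2.symm.trans ha.2.2.2)
  refine ⟨_, hT, ?_⟩
  have hle : ∀ c ∈ V, (V.filter fun b => c ∈ V ∧ c ≠ b ∧ (γ c b).1 = c).card ≤ t c := by
    intro c hc
    rw [← card_range (t c)]
    refine Finset.card_le_card_of_injOn (fun b => (γ c b).2) ?_ ?_
    · intro b hb
      simp only [coe_filter, Set.mem_ofPred_eq] at hb
      have := (hγ c b hc hb.1 hb.2.2.1).2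
      rw [hb.2.2.2] at this
      simpa using this
    · intro b hb b' hb' hbb
      simp only [coe_filter, Set.mem_ofPred_eq] at hb hb'
      have h1 : γ c b = γ c b' :=
        Sigma.ext (hb.2.2.2.trans hb'.2.2.2.symm) (heq_of_eq hbb)
      simp only [γ, dif_pos (hpair c b hc hb.1 hb.2.2.1),
        dif_pos (hpair c b' hc hb'.1 hb'.2.2.1)] at h1
      have h2 := congrArg Subtype.val (hg h1)
      have h3 : b ∈ ({c, b'} : Finset ℕ) := by
        rw [← (show ({c, b} : Finset ℕ) = {c, b'} from h2)]
        simp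
      rcases mem_insert.1 h3 with h4 | h4
      · exact absurd h4.symm hb.2.2.1
      · exact mem_singleton.1 h4
  refine (Finset.sum_eq_sum_iff_of_le hle).1 ?_
  have := hT.sum_card
  omega

/-- A finite set of even size carries a fixed-point free involution. -/
theorem exists_involution_of_even_card (r : ℕ) : ∀ Z : Finset ℕ, Z.card = 2 * r →
    ∃ μ : ℕ → ℕ, ∀ a ∈ Z, μ a ∈ Z ∧ μ a ≠ a ∧ μ (μ a) = a := by
  induction r with
  | zero =>
    intro Z hZ
    refine ⟨id, fun a ha => ?_⟩
    rw [mul_zero, card_eq_zero] at hZ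
    simp [hZ] at ha
  | succ r ih =>
    intro Z hZ
    obtain ⟨x, hx, y, hy, hxy⟩ := Finset.one_lt_card.1 (show 1 < Z.card by omega)
    have hy' : y ∈ Z.erase x := mem_erase.2 ⟨hxy.symm, hy⟩
    obtain ⟨μ, hμ⟩ := ih ((Z.erase x).erase y) (by
      rw [card_erase_of_mem hy', card_erase_of_mem hx]
      omega)
    refine ⟨fun a => if a = x then y else if a = y then x else μ a, fun a ha => ?_⟩
    by_cases hax : a = x
    · subst hax
      simp [hy, hxy.symm]
    by_cases hay : a = y
    · subst hay
      simp [hx, hxy, hax]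
    have h1 := hμ a (by simp [hax, hay, ha])
    simp only [mem_erase] at h1
    simp [hax, hay, h1]

/-- Reversing at most one arc at each vertex makes all scores even. -/
theorem IsTournament.exists_even {W : Finset ℕ} {out : ℕ → Finset ℕ} (h : IsTournament W out)
    (hW : 4 ∣ W.card * (W.card - 1)) :
    ∃ out', IsTournament W out' ∧ (∀ a, Even (out' a).card) ∧
      ∀ a, (out a \ out' a).card ≤ 1 := by
  classical
  let Z := W.filter fun a => Odd (out a).card
  have hZ : Even Z.card := by
    rw [← Finset.even_sum_iff_even_card_odd]
    have := h.sum_card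
    rw [Nat.even_iff]
    omega
  obtain ⟨r, hr⟩ := hZ
  obtain ⟨μ, hμ⟩ := exists_involution_of_even_card r Z (by omega)
  have hZW : ∀ a ∈ Z, a ∈ W := fun a ha => (mem_filter.1 ha).1
  refine ⟨fun a => if a ∈ Z then symmDiff (out a) {μ a} else out a, ?_, ?_, ?_⟩
  · have key : ∀ a b, b ∈ (if a ∈ Z then symmDiff (out a) {μ a} else out a) ↔
        (if a ∈ Z ∧ b = μ a then b ∉ out a else b ∈ out a) := by
      intro a b
      by_cases ha : a ∈ Z
      · simp only [ha, if_true, mem_symmDiff, mem_singleton, true_and]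
        split_ifs <;> tauto
      · simp [ha]
    have flip : ∀ a b, (a ∈ Z ∧ b = μ a) ↔ (b ∈ Z ∧ a = μ b) := by
      intro a b
      constructor
      · rintro ⟨ha, rfl⟩
        exact ⟨(hμ a ha).1, (hμ a ha).2.2.symm⟩
      · rintro ⟨ha, rfl⟩
        exact ⟨(hμ b ha).1, (hμ b ha).2.2.symm⟩
    refine ⟨?_, ?_, ?_, ?_⟩
    · intro a b hb
      rw [key] at hb
      split_ifs at hb with hc
      · exact ⟨hZW a hc.1, hc.2 ▸ hZW _ (hμ a hc.1).1⟩
      · exact h.mem a b hb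
    · intro a ha
      rw [key] at ha
      split_ifs at ha with hc
      · exact (hμ a hc.1).2.1 hc.2.symm
      · exact h.irrefl a ha
    · intro a ha b hb hab
      rw [key, key b a]
      simp only [← flip a b]
      have h1 := h.total a ha b hb hab
      have h2 := h.asymm a b
      split_ifs <;> tauto
    · intro a b hb ha
      rw [key] at hb ha
      simp only [← flip a b] at ha
      have h2 := h.asymm a b
      split_ifs at hb ha with hc
      · have := h.total a (hZW a hc.1) b (hZW b ((flip a b).1 hc).1)
          (fun hab => (hμ a hc.1).2.1 (hab ▸ hc.2.symm))
        tauto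
      · tauto
  · intro a
    by_cases ha : a ∈ Z
    · simp only [ha, if_true]
      have hodd := (mem_filter.1 ha).2
      by_cases hm : μ a ∈ out a
      · have : symmDiff (out a) {μ a} = (out a).erase (μ a) := by
          ext b
          simp only [mem_symmDiff, mem_singleton, mem_erase]
          by_cases hb : b = μ a
          · subst hb; tauto
          · tauto
        rw [this, card_erase_of_mem hm]
        exact hodd.tsub_odd odd_one
      · have : symmDiff (out a) {μ a} = insert (μ a) (out a) := by
          ext b
          simp only [mem_symmDiff, mem_singleton, mem_insert]
          by_cases hb : b = μ a
          · subst hb; tauto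
          · tauto
        rw [this, card_insert_of_notMem hm]
        exact hodd.add_one
    · simp only [ha, if_false]
      by_cases haW : a ∈ W
      · have : ¬ Odd (out a).card := fun ho => ha (mem_filter.2 ⟨haW, ho⟩)
        exact Nat.not_odd_iff_even.1 this
      · have : out a = ∅ := Finset.eq_empty_of_forall_notMem fun b hb => haW (h.mem a b hb).1
        simp [this]
  · intro a
    by_cases ha : a ∈ Z
    · simp only [ha, if_true]
      refine (Finset.card_le_card (t := {μ a}) ?_).trans (card_singleton _).le
      intro b hb
      simp only [mem_sdiff, mem_symmDiff, mem_singleton] at hb ⊢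
      tauto
    · simp [ha]

/-- A tournament on `V` restricted to `V ∩ W` extends to a tournament on `W`. -/
theorem IsTournament.exists_extension {V : Finset ℕ} {out : ℕ → Finset ℕ}
    (h : IsTournament V out) (W : Finset ℕ) :
    ∃ out', IsTournament W out' ∧ ∀ a ∈ W, out a ∩ W ⊆ out' a := by
  classical
  refine ⟨fun a => W.filter fun b => a ∈ W ∧ if a ∈ V ∧ b ∈ V then b ∈ out a else a < b,
    ⟨?_, ?_, ?_, ?_⟩, ?_⟩
  · intro a b hb
    simp only [mem_filter] at hb
    tauto
  · intro a ha
    simp only [mem_filter, lt_irrefl] at ha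
    have := h.irrefl a
    split_ifs at ha <;> tauto
  · intro a ha b hb hab
    have h1 := h.total a
    have h2 := lt_or_gt_of_ne hab
    simp only [mem_filter, and_comm (a := b ∈ V)]
    split_ifs with hc
    · have := h1 hc.1 b hc.2 hab
      tauto
    · tauto
  · intro a b hb ha
    simp only [mem_filter, and_comm (a := b ∈ V)] at hb ha
    split_ifs at hb ha with hc
    · exact h.asymm a b hb.2.2 ha.2.2
    · omega
  · intro a ha b hb
    have hb' := mem_inter.1 hb
    have := h.mem a b hb'.1
    simp [this, hb'.1, hb'.2, ha]

/-- A finite set of size `s * m` can be split into `s` classes of size `m`. -/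
theorem exists_coloring_card_eq (s m : ℕ) (X : Finset ℕ) (hX : X.card = s * m) :
    ∃ g : ℕ → ℕ, (∀ b ∈ X, g b < s) ∧ ∀ i < s, (X.filter fun b => g b = i).card = m := by
  induction s generalizing X with
  | zero =>
    rw [zero_mul, card_eq_zero] at hX
    subst hX
    exact ⟨id, by simp, by simp⟩
  | succ s ih =>
    obtain ⟨Y, hY, hYc⟩ := Finset.exists_subset_card_eq (show m ≤ X.card by rw [hX]; nlinarith)
    obtain ⟨g, hg, hgc⟩ := ih (X \ Y) (by
      rw [card_sdiff_of_subset hY, hX, hYc, add_mul, one_mul, Nat.add_sub_cancel])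
    refine ⟨fun b => if b ∈ Y then s else g b, ?_, ?_⟩
    · intro b hb
      by_cases hbY : b ∈ Y
      · simp [hbY]
      · have := hg b (mem_sdiff.2 ⟨hb, hbY⟩)
        simp only [hbY, if_false]
        omega
    · intro i hi
      by_cases his : i = s
      · rw [← hYc]
        congr 1
        ext b
        simp only [mem_filter]
        constructor
        · rintro ⟨hb, h1⟩
          by_contra hbY
          have := hg b (mem_sdiff.2 ⟨hb, hbY⟩)
          simp only [hbY, if_false] at h1
          omega
        · intro hb
          simp [hY hb, hb, his]
      · rw [← hgc i (by omega)]
        congr 1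
        ext b
        simp only [mem_filter, mem_sdiff]
        by_cases hbY : b ∈ Y
        · simp [hbY, Ne.symm his]
        · simp [hbY]

/-- Two colourings, one of `A` by classes of size `k` and one of `E` by classes of size `2`,
such that every class of the former contains a class of the latter. -/
theorem exists_nested_colorings {k s : ℕ} (hk : 2 ≤ k) {A E : Finset ℕ} (hA : A.card = k * s)
    (hE : Even E.card) (hAE : 2 * s ≤ (A ∩ E).card) :
    ∃ (q : ℕ) (g g' : ℕ → ℕ), s ≤ q ∧
      (∀ b ∈ A, g b < s) ∧ (∀ i < s, (A.filter fun b => g b = i).card = k) ∧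
      (∀ b ∈ E, g' b < q) ∧ (∀ i < q, (E.filter fun b => g' b = i).card = 2) ∧
      ∀ i < s, (E.filter fun b => g' b = i) ⊆ A.filter fun b => g b = i := by
  obtain ⟨D, hD, hDc⟩ := Finset.exists_subset_card_eq hAE
  have hDA : D ⊆ A := hD.trans inter_subset_left
  have hDE : D ⊆ E := hD.trans inter_subset_right
  obtain ⟨e, he⟩ := hE
  have hsE : D.card ≤ E.card := card_le_card hDE
  obtain ⟨d, rfl⟩ := Nat.exists_eq_add_of_le hk
  obtain ⟨γ, hγ, hγc⟩ := exists_coloring_card_eq s 2 D (by omega)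
  obtain ⟨α, hα, hαc⟩ := exists_coloring_card_eq s d (A \ D) (by
    rw [card_sdiff_of_subset hDA, hA, hDc, add_mul, Nat.add_sub_cancel_left, mul_comm])
  obtain ⟨β, hβ, hβc⟩ := exists_coloring_card_eq (e - s) 2 (E \ D) (by
    rw [card_sdiff_of_subset hDE]
    omega)
  refine ⟨e, fun b => if b ∈ D then γ b else α b, fun b => if b ∈ D then γ b else s + β b,
    by omega, ?_, ?_, ?_, ?_, ?_⟩
  · intro b hb
    by_cases hbD : b ∈ D
    · simpa [hbD] using hγ b hbD
    · simpa [hbD] using hα b (mem_sdiff.2 ⟨hb, hbD⟩)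
  · intro i hi
    have : (A.filter fun b => (if b ∈ D then γ b else α b) = i) =
        (D.filter fun b => γ b = i) ∪ ((A \ D).filter fun b => α b = i) := by
      ext b
      have := @hDA b
      by_cases hbD : b ∈ D <;> simp [hbD]
      tauto
    rw [this, card_union_of_disjoint, hγc i hi, hαc i hi]
    exact disjoint_filter_filter disjoint_sdiff
  · intro b hb
    by_cases hbD : b ∈ D
    · have := hγ b hbD
      simp only [hbD, if_true]
      omega
    · have := hβ b (mem_sdiff.2 ⟨hb, hbD⟩)
      simp only [hbD, if_false]
      omega
  · intro i hi
    by_cases his : i < s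
    · rw [← hγc i his]
      congr 1
      ext b
      have := @hDE b
      by_cases hbD : b ∈ D <;> simp [hbD]
      · tauto
      · omega
    · rw [← hβc (i - s) (by omega)]
      congr 1
      ext b
      by_cases hbD : b ∈ D
      · have := hγ b hbD
        simp [hbD]
        omega
      · simp only [mem_filter, hbD, if_false, mem_sdiff, not_false_eq_true, and_true]
        refine and_congr_right fun _ => ?_
        omega
  · intro i hi b hb
    rw [mem_filter] at hb ⊢
    by_cases hbD : b ∈ D
    · simpa [hbD, hDA hbD] using hb.2
    · simp only [hbD, if_false] at hb
      omega


/-- The star with centre `c` and set of leaves `L`. -/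
def starBlock (c : ℕ) (L : Finset ℕ) : LGraph ℕ where
  verts := insert c (L : Set ℕ)
  Adj a b := a ≠ b ∧ (a = c ∧ b ∈ L ∨ b = c ∧ a ∈ L)
  adj_sub h := h.1
  edge_vert := by
    rintro a b ⟨-, ⟨rfl, -⟩ | ⟨-, h⟩⟩
    · exact Set.mem_insert _ _
    · exact Set.mem_insert_of_mem _ h
  symm := ⟨fun a b h => ⟨h.1.symm, h.2.symm⟩⟩

theorem starBlock_mono {c : ℕ} {L M : Finset ℕ} (h : L ⊆ M) : starBlock c L ≤ starBlock c M := by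
  refine ⟨Set.insert_subset_insert (by exact_mod_cast h), fun a b hab => ⟨hab.1, ?_⟩⟩
  rcases hab.2 with h1 | h1
  · exact Or.inl ⟨h1.1, h h1.2⟩
  · exact Or.inr ⟨h1.1, h h1.2⟩

theorem nonempty_iso_starBlock {c k : ℕ} {L : Finset ℕ} (hc : c ∉ L) (hL : L.card = k) :
    Nonempty ((starBlock c L).coe ≃g star k) := by
  let e := (L.equivFinOfCardEq hL).symm
  let φ : Fin 1 ⊕ Fin k → (starBlock c L).verts :=
    Sum.elim (fun _ => ⟨c, Set.mem_insert _ _⟩) fun i => ⟨e i, Set.mem_insert_of_mem _ (e i).2⟩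
  have hne : ∀ i, (e i : ℕ) ≠ c := fun i h => hc (h ▸ (e i).2)
  have hφ : Function.Bijective φ := by
    constructor
    · rintro (i | i) (j | j) h
      · rw [Subsingleton.elim i j]
      · exact absurd (congrArg Subtype.val h).symm (hne j)
      · exact absurd (congrArg Subtype.val h) (hne i)
      · have h1 : (e i : ℕ) = e j := Subtype.mk.inj h
        rw [e.injective (Subtype.ext h1)]
    · rintro ⟨a, rfl | ha⟩
      · exact ⟨Sum.inl 0, rfl⟩
      · exact ⟨Sum.inr (e.symm ⟨a, ha⟩), by simp [φ]⟩
  refine ⟨RelIso.symm ⟨Equiv.ofBijective φ hφ, ?_⟩⟩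
  intro a b
  change (starBlock c L).Adj (φ a) (φ b) ↔ _
  rcases a with i | i <;> rcases b with j | j
  · simp [φ, starBlock]
  · simp [φ, starBlock, (hne j).symm]
  · simp [φ, starBlock, hne i]
  · simp [φ, starBlock, hne]

theorem eq_starBlock_of_iso {k : ℕ} {B : LGraph ℕ} (h : Nonempty (B.coe ≃g star k)) :
    ∃ c L, c ∉ L ∧ L.card = k ∧ B = starBlock c L := by
  obtain ⟨φ⟩ := h
  let ψ := φ.symm
  have hinj : ∀ a b, (ψ a : ℕ) = ψ b → a = b := fun a b hab => ψ.injective (Subtype.ext hab)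
  refine ⟨ψ (Sum.inl 0), univ.image fun i => (ψ (Sum.inr i) : ℕ), ?_, ?_, ?_⟩
  · intro hm
    obtain ⟨i, -, hi⟩ := mem_image.1 hm
    exact absurd (hinj _ _ hi) (by simp)
  · rw [card_image_of_injective _ fun i j hij => Sum.inr_injective (hinj _ _ hij)]
    simp
  · have hsurj : ∀ a ∈ B.verts, ∃ x, (ψ x : ℕ) = a := fun a ha =>
      ⟨φ ⟨a, ha⟩, by simp [ψ]⟩
    have hadj : ∀ x y, B.Adj (ψ x) (ψ y) ↔ (star k).Adj x y := fun x y => ψ.map_rel_iff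
    refine SimpleGraph.Subgraph.ext ?_ ?_
    · ext a
      simp only [starBlock, coe_image, coe_univ, Set.image_univ, Set.mem_insert_iff,
        Set.mem_range]
      constructor
      · intro ha
        obtain ⟨x | x, rfl⟩ := hsurj a ha
        · exact Or.inl (by rw [Subsingleton.elim x 0])
        · exact Or.inr ⟨x, rfl⟩
      · rintro (rfl | ⟨i, rfl⟩)
        · exact Subtype.coe_prop _
        · exact Subtype.coe_prop _
    · funext a b
      apply propext
      constructor
      · intro hab
        obtain ⟨x, rfl⟩ := hsurj a hab.fst_mem
        obtain ⟨y, rfl⟩ := hsurj b hab.snd_mem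
        refine ⟨hab.ne, ?_⟩
        have h1 := (hadj x y).1 hab
        rcases x with x | x <;> rcases y with y | y
        · simp at h1
        · exact Or.inl ⟨by rw [Subsingleton.elim x 0], mem_image_of_mem _ (mem_univ y)⟩
        · exact Or.inr ⟨by rw [Subsingleton.elim y 0], mem_image_of_mem _ (mem_univ x)⟩
        · simp at h1
      · rintro ⟨-, ⟨rfl, hb⟩ | ⟨rfl, ha⟩⟩
        · obtain ⟨i, -, rfl⟩ := mem_image.1 hb
          exact (hadj _ _).2 (by simp)
        · obtain ⟨i, -, rfl⟩ := mem_image.1 ha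
          exact (hadj _ _).2 (by simp)

theorem nonempty_star_two_iso_P₃ : Nonempty (star 2 ≃g P₃) := by
  refine ⟨⟨⟨fun x => Sum.elim (fun _ => 1) (fun i => if i = 0 then 0 else 2) x,
    fun i => if i = 1 then Sum.inl 0 else if i = 0 then Sum.inr 0 else Sum.inr 1, ?_, ?_⟩, ?_⟩⟩
  · intro x
    revert x
    decide
  · intro x
    revert x
    decide
  · intro a b
    simp only [Equiv.coe_fn_mk, SimpleGraph.pathGraph_adj]
    rcases a with i | i <;> rcases b with j | j <;> fin_cases i <;> fin_cases j <;> simp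

theorem mem_edgeSet_complete {V : Finset ℕ} {a b : ℕ} :
    s(a, b) ∈ (complete (V : Set ℕ)).edgeSet ↔ a ∈ V ∧ b ∈ V ∧ a ≠ b := by
  simp [complete]

theorem mem_edgeSet_starBlock {c : ℕ} {L : Finset ℕ} {a b : ℕ} :
    s(a, b) ∈ (starBlock c L).edgeSet ↔ a ≠ b ∧ (a = c ∧ b ∈ L ∨ b = c ∧ a ∈ L) :=
  Iff.rfl

/-- The stars cut out by a colouring of the arcs of a tournament. -/
def blocks (out : ℕ → Finset ℕ) (q : ℕ → ℕ) (g : ℕ → ℕ → ℕ) : Set (LGraph ℕ) :=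
  {B | ∃ c, ∃ i < q c, B = starBlock c ((out c).filter fun b => g c b = i)}

theorem IsTournament.isDesign_blocks {V : Finset ℕ} {out : ℕ → Finset ℕ} {q : ℕ → ℕ}
    {g : ℕ → ℕ → ℕ} {k : ℕ} (h : IsTournament V out) (hk : 0 < k)
    (hg : ∀ c, ∀ b ∈ out c, g c b < q c)
    (hc : ∀ c, ∀ i < q c, ((out c).filter fun b => g c b = i).card = k) :
    IsDesign (blocks out q g) (complete (V : Set ℕ)) (star k) := by
  refine ⟨?_, ?_, ?_⟩
  · rintro B ⟨c, i, hi, rfl⟩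
    have hcV : c ∈ V := by
      obtain ⟨b, hb⟩ := card_pos.1 (show 0 < ((out c).filter fun b => g c b = i).card by
        rw [hc c i hi]; exact hk)
      exact (h.mem c b (mem_filter.1 hb).1).1
    have hsub : ∀ b ∈ (out c).filter fun b => g c b = i, b ∈ V := fun b hb =>
      (h.mem c b (mem_filter.1 hb).1).2
    refine ⟨?_, ?_⟩
    · rintro a (rfl | ha)
      · exact hcV
      · exact hsub a ha
    · rintro a b ⟨hab, ⟨rfl, hb⟩ | ⟨rfl, ha⟩⟩
      · exact ⟨hcV, hsub b hb, hab⟩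
      · exact ⟨hsub a ha, hcV, hab⟩
  · rintro B ⟨c, i, hi, rfl⟩
    exact nonempty_iso_starBlock (fun h' => h.irrefl c (mem_filter.1 h').1) (hc c i hi)
  · have key : ∀ a b, b ∈ out a →
        ∃! B, B ∈ blocks out q g ∧ s(a, b) ∈ B.edgeSet := by
      intro a b hb
      have hab : a ≠ b := fun h' => h.irrefl a (by rwa [← h'] at hb)
      refine ⟨_, ⟨⟨a, g a b, hg a b hb, rfl⟩, hab, Or.inl ⟨rfl, by simp [hb]⟩⟩, ?_⟩
      rintro B ⟨⟨c, i, hi, rfl⟩, -, ⟨rfl, hb'⟩ | ⟨rfl, ha'⟩⟩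
      · rw [(mem_filter.1 hb').2]
      · exact absurd (mem_filter.1 ha').1 (h.asymm a b hb)
    intro e
    induction e with
    | h a b =>
      intro he
      obtain ⟨ha, hb, hab⟩ := mem_edgeSet_complete.1 he
      rcases h.total a ha b hb hab with h' | h'
      · exact key a b h'
      · rw [Sym2.eq_swap]
        exact key b a h'

theorem IsDesign.of_iso {α β γ : Type*} {𝓑 : Set (LGraph α)} {K : LGraph α}
    {Γ : SimpleGraph β} {Δ : SimpleGraph γ} (h : IsDesign 𝓑 K Γ) (φ : Nonempty (Γ ≃g Δ)) :
    IsDesign 𝓑 K Δ :=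
  ⟨h.le, fun B hB => ⟨(h.iso B hB).some.trans φ.some⟩, h.existsUnique⟩

theorem starBlock_edgeFinset {c : ℕ} {L : Finset ℕ} (hc : c ∉ L) :
    (starBlock c L).edgeSet = ((L.image fun b => s(c, b) : Finset (Sym2 ℕ)) : Set (Sym2 ℕ)) := by
  ext e
  induction e with
  | h a b =>
    rw [mem_edgeSet_starBlock, coe_image, Set.mem_image]
    constructor
    · rintro ⟨-, ⟨rfl, hb⟩ | ⟨rfl, ha⟩⟩
      · exact ⟨b, hb, rfl⟩
      · exact ⟨a, ha, Sym2.eq_swap⟩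
    · rintro ⟨x, hx, hxe⟩
      have hxc : c ≠ x := fun h => hc (h ▸ hx)
      rcases Sym2.eq_iff.1 hxe with ⟨rfl, rfl⟩ | ⟨rfl, rfl⟩
      · exact ⟨hxc, Or.inl ⟨rfl, hx⟩⟩
      · exact ⟨hxc.symm, Or.inr ⟨rfl, hx⟩⟩

theorem IsDesign.dvd_choose_two {W : Finset ℕ} {𝓑 : Set (LGraph ℕ)} {k : ℕ}
    (h : IsDesign 𝓑 (complete (W : Set ℕ)) (star k)) : k ∣ W.card.choose 2 := by
  classical
  let E : Finset (Sym2 ℕ) := W.offDiag.image Sym2.mk.uncurry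
  have hE : ∀ e, e ∈ E ↔ e ∈ (complete (W : Set ℕ)).edgeSet := by
    intro e
    induction e with
    | h a b =>
      rw [mem_edgeSet_complete]
      simp only [E, mem_image, mem_offDiag, Prod.exists]
      constructor
      · rintro ⟨x, y, hxy, hxe⟩
        rcases Sym2.eq_iff.1 hxe with ⟨rfl, rfl⟩ | ⟨rfl, rfl⟩
        · exact hxy
        · exact ⟨hxy.2.1, hxy.1, hxy.2.2.symm⟩
      · intro hab
        exact ⟨a, b, hab, rfl⟩
  have hcard : E.card = W.card.choose 2 := Sym2.card_image_offDiag W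
  choose! β hβ huniq using h.existsUnique
  rw [← hcard, Finset.card_eq_sum_card_image β E]
  refine Finset.dvd_sum fun B hB => ?_
  obtain ⟨e, he, rfl⟩ := mem_image.1 hB
  have hB𝓑 := (hβ e ((hE e).1 he)).1
  obtain ⟨c, L, hc, hL, hBeq⟩ := eq_starBlock_of_iso (h.iso _ hB𝓑)
  have : E.filter (fun x => β x = β e) = L.image fun b => s(c, b) := by
    rw [← Finset.coe_inj, ← starBlock_edgeFinset hc, ← hBeq]
    ext x
    simp only [coe_filter, Set.mem_ofPred_eq]
    constructor
    · rintro ⟨hx, hxe⟩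
      rw [← hxe]
      exact (hβ x ((hE x).1 hx)).2
    · intro hx
      have hxK := SimpleGraph.Subgraph.edgeSet_mono (h.le _ hB𝓑) hx
      exact ⟨(hE x).2 hxK, (huniq x hxK _ ⟨hB𝓑, hx⟩).symm⟩
  rw [this, card_image_of_injective _ fun x y hxy => Sym2.congr_right.1 hxy, hL]

theorem center_eq_of_starBlock_le {c c' : ℕ} {L L' : Finset ℕ} (hc' : c' ∉ L')
    (hL' : 2 ≤ L'.card) (h : starBlock c' L' ≤ starBlock c L) : c' = c := by
  by_contra hne
  obtain ⟨x, hx, y, hy, hxy⟩ := Finset.one_lt_card.1 hL'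
  have key : ∀ z ∈ L', z = c := by
    intro z hz
    have h1 := h.2 (show (starBlock c' L').Adj c' z from
      ⟨fun h' => hc' (h' ▸ hz), Or.inl ⟨rfl, hz⟩⟩)
    rcases h1.2 with h2 | h2
    · exact absurd h2.1 hne
    · exact h2.1
  exact hxy ((key x hx).trans (key y hy).symm)

/-- A down-link from a star design to a `P₃`-design misses at most one vertex. -/
theorem card_le_of_isDownLink {V W : Finset ℕ} {𝓑 𝓑' : Set (LGraph ℕ)} {k l : ℕ} (hl : 2 ≤ l)
    (h : IsDesign 𝓑 (complete (V : Set ℕ)) (star k))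
    (h' : IsDesign 𝓑' (complete (W : Set ℕ)) (star l)) {f : 𝓑 → 𝓑'} (hf : IsDownLink f) :
    V.card - 1 ≤ W.card := by
  have hsub : (V \ W).card ≤ 1 := by
    rw [Finset.card_le_one]
    intro x hx y hy
    by_contra hxy
    rw [mem_sdiff] at hx hy
    obtain ⟨B, ⟨hB, he⟩, -⟩ := h.existsUnique s(x, y)
      (mem_edgeSet_complete.2 ⟨hx.1, hy.1, hxy⟩)
    obtain ⟨c, L, -, -, rfl⟩ := eq_starBlock_of_iso (h.iso B hB)
    have h1 := hf ⟨_, hB⟩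
    obtain ⟨c', L', hc', hL', hB'⟩ := eq_starBlock_of_iso (h'.iso _ (f ⟨_, hB⟩).2)
    have h2 := h'.le _ (f ⟨_, hB⟩).2
    rw [hB'] at h1 h2
    have hcW : c ∈ W := by
      rw [← center_eq_of_starBlock_le hc' (hL' ▸ hl) h1]
      exact h2.1 (Set.mem_insert _ _)
    rcases (mem_edgeSet_starBlock.1 he).2 with ⟨rfl, -⟩ | ⟨rfl, -⟩
    · exact hx.2 hcW
    · exact hy.2 hcW
  have := Finset.card_sdiff_add_card_inter V W
  have := Finset.card_le_card (Finset.inter_subset_right : V ∩ W ⊆ W)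
  omega

/-- Scores with total `S` on `v` vertices satisfying Landau's condition, one vertex having
score zero. -/
theorem exists_scores {k v S : ℕ} (hv₁ : 2 * k ≤ v) (hv₂ : v < 4 * k)
    (hS : v * (v - 1) = 2 * (k * S)) :
    ∃ s : ℕ → ℕ, (∀ c, s c = 0 ↔ v - 1 ≤ c) ∧ v * (v - 1) = 2 * ∑ c ∈ range v, k * s c ∧
      ∀ X ⊆ range v, X.card * (X.card - 1) ≤ 2 * ∑ c ∈ X, k * s c := by
  obtain ⟨w, rfl⟩ : ∃ w, v = w + 1 := ⟨v - 1, by omega⟩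
  simp only [Nat.add_sub_cancel] at hS ⊢
  have hk : 0 < k := by omega
  have hS₁ : w ≤ S := by
    by_contra! hlt
    nlinarith
  have hS₂ : S ≤ 2 * w := by
    by_contra! hlt
    nlinarith
  let s : ℕ → ℕ := fun c => if c < S - w then 2 else if c < w then 1 else 0
  have hs : ∀ c, s c = 0 ↔ w ≤ c := by
    intro c
    simp only [s]
    split_ifs <;> simp <;> omega
  have hle : ∀ c, s c ≤ 2 := by
    intro c
    simp only [s]
    split_ifs <;> omega
  have hsum : ∑ c ∈ range (w + 1), s c = S := by
    have h1 : ∀ c ∈ range (w + 1), s c =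
        (if c < S - w then 1 else 0) + if c < w then 1 else 0 := by
      intro c _
      simp only [s]
      split_ifs <;> omega
    have h2 : ∀ m ≤ w, ((range (w + 1)).filter fun c => c < m) = range m := by
      intro m hm
      ext c
      simp only [mem_filter, mem_range]
      omega
    rw [sum_congr rfl h1, sum_add_distrib, ← card_filter, ← card_filter, h2 _ (by omega),
      h2 _ le_rfl, card_range, card_range]
    omega
  refine ⟨s, hs, by rw [← mul_sum, hsum, hS], ?_⟩
  intro X hX
  rw [← mul_sum]
  have hlow : X.card - 1 ≤ ∑ c ∈ X, s c := by
    have h1 : X.card - 1 ≤ (X.erase w).card := by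
      have := Finset.pred_card_le_card_erase (s := X) (a := w)
      omega
    refine h1.trans ?_
    rw [Finset.card_eq_sum_ones]
    refine (Finset.sum_le_sum fun c hc => ?_).trans
      (Finset.sum_le_sum_of_subset (Finset.erase_subset w X))
    have hc' := mem_range.1 (hX (mem_erase.1 hc).2)
    have := mt (hs c).1 (by have := (mem_erase.1 hc).1; omega)
    omega
  have hup : S ≤ ∑ c ∈ X, s c + 2 * (w + 1 - X.card) := by
    rw [← hsum, ← Finset.sum_sdiff hX, add_comm]
    refine Nat.add_le_add_left ?_ _
    refine (Finset.sum_le_card_nsmul _ _ 2 fun c _ => hle c).trans ?_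
    rw [card_sdiff_of_subset hX, card_range, smul_eq_mul, mul_comm]
  have hXc : X.card ≤ w + 1 := by simpa using card_le_card hX
  generalize ∑ c ∈ X, s c = σ at *
  generalize X.card = j at *
  rcases Nat.eq_zero_or_pos j with rfl | hj
  · simp
  obtain ⟨j, rfl⟩ : ∃ i, j = i + 1 := ⟨j - 1, by omega⟩
  simp only [Nat.add_sub_cancel] at hlow ⊢
  by_cases hj2 : j + 1 ≤ 2 * k
  · nlinarith
  · obtain ⟨i, rfl⟩ : ∃ i, w = j + i := ⟨w - j, by omega⟩
    have h1 : S ≤ σ + 2 * i := by omega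
    have h2 : k * S ≤ k * (σ + 2 * i) := Nat.mul_le_mul_left k h1
    have h3 : 2 * k * i ≤ j * i := Nat.mul_le_mul_right i (by omega)
    nlinarith

theorem exists_isDownLink {k v n : ℕ} (hk3 : 3 < k) (hv₁ : 2 * k ≤ v) (hv₂ : v < 4 * k)
    (hv : 2 * k ∣ v * (v - 1)) (hn : v - 1 ≤ n) (hn4 : 4 ∣ n * (n - 1)) :
    ∃ 𝓑 𝓑' : Set (LGraph ℕ), IsDesign 𝓑 (complete (range v : Set ℕ)) (star k) ∧
      IsDesign 𝓑' (complete (range n : Set ℕ)) (star 2) ∧ ∃ f : 𝓑 → 𝓑', IsDownLink f := by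
  obtain ⟨S, hS⟩ := hv
  obtain ⟨s, hs, hsum, hX⟩ := exists_scores hv₁ hv₂ (hS.trans (mul_assoc _ _ _))
  obtain ⟨T, hT, hTc⟩ := exists_isTournament_card_eq (range v) (fun c => k * s c) hX
    (by rw [card_range, hsum])
  obtain ⟨O, hO, hTO⟩ := hT.exists_extension (range n)
  obtain ⟨O', hO', heven, hOO⟩ := hO.exists_even (by rwa [card_range])
  have hTc' : ∀ c, (T c).card = k * s c := by
    intro c
    by_cases hc : c ∈ range v
    · exact hTc c hc
    · rw [(hs c).2 (by rw [mem_range] at hc; omega), mul_zero, card_eq_zero]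
      exact Finset.eq_empty_of_forall_notMem fun b hb => hc (hT.mem c b hb).1
  have hcommon : ∀ c, 2 * s c ≤ (T c ∩ O' c).card := by
    intro c
    by_cases hc0 : s c = 0
    · simp [hc0]
    have hcn : c ∈ range n := by
      have := mt (hs c).2 hc0
      rw [mem_range]
      omega
    have h1 : T c ⊆ (T c ∩ O' c) ∪ (O c \ O' c) ∪ {v - 1} := by
      intro b hb
      by_cases hbv : b = v - 1
      · simp [hbv]
      have hbV := mem_range.1 (hT.mem c b hb).2
      have hbO := hTO c hcn (mem_inter.2 ⟨hb, mem_range.2 (show b < n by omega)⟩)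
      simp only [mem_union, mem_inter, mem_sdiff]
      tauto
    have h2 := card_le_card h1
    have h3 := card_union_le ((T c ∩ O' c) ∪ (O c \ O' c)) {v - 1}
    have h4 := card_union_le (T c ∩ O' c) (O c \ O' c)
    have h5 := hOO c
    rw [hTc'] at h2
    rw [card_singleton] at h3
    have h6 : 4 * s c ≤ k * s c := Nat.mul_le_mul_right _ hk3
    omega
  choose q g g' hsq hg hgc hg' hgc' hsub using fun c =>
    exists_nested_colorings (show 2 ≤ k by omega) (hTc' c) (heven c) (hcommon c)
  have hex : ∀ B : blocks T s g, ∃ B' : blocks O' q g', (B' : LGraph ℕ) ≤ B := by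
    rintro ⟨B, c, i, hi, rfl⟩
    exact ⟨⟨_, c, i, hi.trans_le (hsq c), rfl⟩, starBlock_mono (hsub c i hi)⟩
  choose f hf using hex
  exact ⟨_, _, hT.isDesign_blocks (by omega) hg hgc, hO'.isDesign_blocks two_pos hg' hgc', f, hf⟩

theorem order_eq_of_isPrimePow {k v : ℕ} (hk : IsPrimePow k) (hk3 : 3 < k) (hv₁ : 2 * k ≤ v)
    (hv₂ : v < 4 * k) (hv : 2 * k ∣ v * (v - 1)) :
    v = 2 * k ∨ v = 2 * k + 1 ∨ v = 3 * k ∨ v = 3 * k + 1 := by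
  have hcop : Nat.Coprime v (v - 1) := by
    obtain ⟨w, rfl⟩ : ∃ w, v = w + 1 := ⟨v - 1, by omega⟩
    simp
  rcases (hcop.isPrimePow_dvd_mul hk).1 (dvd_of_mul_left_dvd hv) with ⟨m, hm⟩ | ⟨m, hm⟩
  all_goals
    have h1 : m < 4 := by
      by_contra! h
      have := Nat.mul_le_mul_left k h
      omega
    have h2 : 1 < m := by
      by_contra! h
      have := Nat.mul_le_mul_left k h
      omega
    interval_cases m <;> omega

end DownLink

theorem mainTheorem11 (k v : ℕ) (hk : IsPrimePow k) (hk3 : 3 < k)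
    (hv₁ : 2 * k ≤ v) (hv₂ : v < 4 * k) (hv : v * (v - 1) ≡ 0 [MOD 2 * k]) :
    (v = 2 * k ∨ v = 2 * k + 1 ∨ v = 3 * k ∨ v = 3 * k + 1) ∧
      DownLink.L₁ (DownLink.star k) DownLink.P₃ v =
        {n : ℕ | v - 1 ≤ n ∧ (n ≡ 0 [MOD 4] ∨ n ≡ 1 [MOD 4])} := by
  have hdvd := (Nat.modEq_zero_iff_dvd).1 hv
  have hmod : ∀ n : ℕ, 4 ∣ n * (n - 1) ↔ (n ≡ 0 [MOD 4] ∨ n ≡ 1 [MOD 4]) := by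
    rintro (_ | n)
    · simp [Nat.ModEq]
    · have : n % 4 < 4 := Nat.mod_lt _ (by norm_num)
      rw [Nat.add_sub_cancel, Nat.dvd_iff_mod_eq_zero, Nat.mul_mod, Nat.add_mod]
      simp only [Nat.ModEq, Nat.add_mod n 1 4]
      interval_cases n % 4 <;> simp
  refine ⟨DownLink.order_eq_of_isPrimePow hk hk3 hv₁ hv₂ hdvd, ?_⟩
  ext n
  constructor
  · rintro ⟨V, W, rfl, rfl, 𝓑, 𝓑', h, h', f, hf⟩
    have h'' := h'.of_iso ⟨DownLink.nonempty_star_two_iso_P₃.some.symm⟩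
    refine ⟨DownLink.card_le_of_isDownLink le_rfl h h'' hf, (hmod _).1 ?_⟩
    have h2 := h''.dvd_choose_two
    rw [Nat.choose_two_right] at h2
    have h4 := Nat.even_mul_pred_self W.card
    rw [Nat.even_iff] at h4
    omega
  · rintro ⟨hn, hn4⟩
    obtain ⟨𝓑, 𝓑', h, h', f⟩ :=
      DownLink.exists_isDownLink hk3 hv₁ hv₂ hdvd hn ((hmod n).2 hn4)
    exact ⟨Finset.range v, Finset.range n, Finset.card_range v, Finset.card_range n, 𝓑, 𝓑', h,
      h'.of_iso DownLink.nonempty_star_two_iso_P₃, f⟩
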